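/- For $1<p<\infty$ let $H_p^{+}$ (resp. $H_p^-$) be the Hardy space of the upper half-plane $\{\operatorname{Im} z>0\}$ (resp. of the lower half-plane $\{\operatorname{Im} z<0\}$), identified through boundary values with a closed subspace of $L_p(\mathbb R)$, and put $\mathcal H_p^{\pm}=\lambda_\pm H_p^{\pm}$, where $\lambda_\pm(\xi)=\xi\pm i$. Let $r(\xi)=\frac{\xi-i}{\xi+i}$ for $\xi\in\mathbb R$. For $j,s\in(1,\infty)$ with $\frac1j+\frac1s\le 1$, a $(j,s)$-factorization with index $k\in\mathbb Z$ of a function $g:\mathbb R\to\mathbb C$ is a representation $g=g_-r^kg_+$ (a.e. on $\mathbb R$), with $g_\pm\neq0$ a.e. and $$g_-\in\mathcal H_j^-,\qquad g_-^{-1}\in\mathcal H_s^-,\qquad g_+\in\mathcal H_s^+,\qquad g_+^{-1}\in\mathcal H_j^+ .$$ **Proposition.** Let $g=g_-r^kg_+$ and $g=\tilde g_-r^{\tilde k}\tilde g_+$ be two $(j,s)$-factorizations of the same function $g$, with $k\ge\tilde k$, and let $\frac1j+\frac1{j'}=1$. Equalities between functions are understood a.e. on $\mathbb R$. (i) If $g_+\in\mathcal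 H_{j'}^+$ and $g_-^{-1}\in\mathcal H_{j'}^-$, then $k=\tilde k$ and $g_+\tilde g_+^{-1}=\tilde g_-g_-^{-1}=C$ for some constant $C\in\mathbb C\setminus\{0\}$. (ii) If $s\ne j'$, then $0\le k-\tilde k\le 1$, and moreover: - if $k=\tilde k$, then $g_+\tilde g_+^{-1}=\tilde g_-g_-^{-1}=C$ for some $C\in\mathbb C\setminus\{0\}$; - if $k-\tilde k=1$, then $\tilde g_+=\dfrac1C\,\dfrac{g_+}{\xi+i}$ and $\tilde g_-=C(\xi-i)\,g_-$ for some $C\in\mathbb C\setminus\{0\}$. -/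

import Mathlib

open MeasureTheory Filter Topology

namespace JSFactorization

noncomputable section

/-- The Hardy space `H_p^+` of the upper half-plane `Im z > 0`, viewed as a space of functions on
`ℝ` (up to a.e. equality): `f` is the boundary function, in the sense of `L_p`-convergence along
horizontal lines, of a function `F` holomorphic in the half-plane with
`sup_{y > 0} ‖F(· + iy)‖_p < ∞`. -/
def HardyPlus (p : ℝ) : Set (ℝ → ℂ) :=
  {f | MemLp f (ENNReal.ofReal p) volume ∧
    ∃ F : ℂ → ℂ, DifferentiableOn ℂ F {z : ℂ | 0 < z.im} ∧
      (∃ M : NNReal, ∀ y : ℝ, 0 < y →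
        eLpNorm (fun x : ℝ => F (x + y * Complex.I)) (ENNReal.ofReal p) volume ≤ M) ∧
      Tendsto
        (fun y : ℝ => eLpNorm (fun x : ℝ => F (x + y * Complex.I) - f x)
          (ENNReal.ofReal p) volume)
        (𝓝[>] 0) (𝓝 0)}

/-- The Hardy space `H_p^-` of the lower half-plane `Im z < 0`, viewed in the same way as a space
of functions on `ℝ`. -/
def HardyMinus (p : ℝ) : Set (ℝ → ℂ) :=
  {f | MemLp f (ENNReal.ofReal p) volume ∧
    ∃ F : ℂ → ℂ, DifferentiableOn ℂ F {z : ℂ | z.im < 0} ∧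
      (∃ M : NNReal, ∀ y : ℝ, 0 < y →
        eLpNorm (fun x : ℝ => F (x - y * Complex.I)) (ENNReal.ofReal p) volume ≤ M) ∧
      Tendsto
        (fun y : ℝ => eLpNorm (fun x : ℝ => F (x - y * Complex.I) - f x)
          (ENNReal.ofReal p) volume)
        (𝓝[>] 0) (𝓝 0)}

/-- `λ_+(ξ) = ξ + i`. -/
def lamPlus (x : ℝ) : ℂ := (x : ℂ) + Complex.I

/-- `λ_-(ξ) = ξ - i`. -/
def lamMinus (x : ℝ) : ℂ := (x : ℂ) - Complex.I

/-- `r(ξ) = (ξ - i) / (ξ + i)`. -/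
def r (x : ℝ) : ℂ := lamMinus x / lamPlus x

/-- `𝓗_p^+ = λ_+ H_p^+` (note that `λ_+` has no zero on `ℝ`). -/
def CalHPlus (p : ℝ) : Set (ℝ → ℂ) :=
  {f | (fun x => f x / lamPlus x) ∈ HardyPlus p}

/-- `𝓗_p^- = λ_- H_p^-` (note that `λ_-` has no zero on `ℝ`). -/
def CalHMinus (p : ℝ) : Set (ℝ → ℂ) :=
  {f | (fun x => f x / lamMinus x) ∈ HardyMinus p}

/-- `g = g_- r^k g_+` (a.e. on `ℝ`) is a `(j,s)`-factorization of `g` with index `k`.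
The factors are nonzero a.e., so that their inverses make sense. -/
structure IsFactorization (j s : ℝ) (g : ℝ → ℂ) (k : ℤ) (gm gp : ℝ → ℂ) : Prop where
  one_lt_j : 1 < j
  one_lt_s : 1 < s
  inv_add_inv_le : 1 / j + 1 / s ≤ 1
  minus_ne_zero : ∀ᵐ x : ℝ, gm x ≠ 0
  plus_ne_zero : ∀ᵐ x : ℝ, gp x ≠ 0
  eq_mul : ∀ᵐ x : ℝ, g x = gm x * r x ^ k * gp x
  minus_mem : gm ∈ CalHMinus j
  minus_inv_mem : (fun x => (gm x)⁻¹) ∈ CalHMinus s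
  plus_mem : gp ∈ CalHPlus s
  plus_inv_mem : (fun x => (gp x)⁻¹) ∈ CalHPlus j

end

end JSFactorization

namespace JSFactorization

open scoped ENNReal FourierTransform Polynomial

/-! Put n = k - k̃ ≥ 0. Comparing the two factorizations gives g_+ g̃_+⁻¹ λ_+^{-n} = g̃_- g_-⁻¹
λ_-^{-n}. The left side extends holomorphically to the upper half-plane and the right side to the
lower one. By Hölder, each becomes an H_1 function after division by λ_+³, resp. λ_-³. The Liouville
theorem `exists_polynomial` then makes the common value a polynomial P, nonzero because the factors
are.

Integrability at infinity does the rest. The function P λ_+^{n-2} lies in L_q with 1/q = 1/s + 1/j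
and 1 ≤ q < ∞, while a nonzero polynomial stays away from 0 near +∞. Hence n ≤ 1, and if n = 1 and q
> 1, then P is constant. If g_+ ∈ 𝓗_{j'}^+, then q = 1 is available, and n ≥ 1 is excluded because
1/x is not integrable at infinity. If n = 0, exchanging the factorizations yields a polynomial
inverse of P, so P is constant.

The Liouville theorem is an induction on the order of growth, lowered by passing to (f - c)/(x - i).
At the bottom, an integrable function lies in H_1 from both sides, so its Fourier transform vanishes
on both half-lines. -/

/-- `F` is holomorphic in the upper half-plane with uniformly bounded `L_p` norms along horizontal
lines, and `f` is its boundary function in the sense of `L_p` convergence. -/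
structure IsHardy (p : ℝ≥0∞) (F : ℂ → ℂ) (f : ℝ → ℂ) : Prop where
  memLp : MemLp f p volume
  diff : DifferentiableOn ℂ F {z : ℂ | 0 < z.im}
  bound : ∃ M : NNReal, ∀ y : ℝ, 0 < y →
    eLpNorm (fun x : ℝ => F (x + y * Complex.I)) p volume ≤ M
  tendsto : Tendsto (fun y : ℝ => eLpNorm (fun x : ℝ => F (x + y * Complex.I) - f x) p volume)
    (𝓝[>] 0) (𝓝 0)

/-! ### Reflection and algebra of Hardy functions -/

theorem mem_hardyPlus_iff {p : ℝ} {f : ℝ → ℂ} :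
    f ∈ HardyPlus p ↔ ∃ F, IsHardy (ENNReal.ofReal p) F f :=
  ⟨fun ⟨h, F, h1, h2, h3⟩ => ⟨F, h, h1, h2, h3⟩, fun ⟨F, h⟩ => ⟨h.1, F, h.2, h.3, h.4⟩⟩

/-- The map z ↦ -z exchanges the half-planes, so only the upper one needs to be studied. -/
theorem comp_neg_mem_hardyPlus {p : ℝ} {f : ℝ → ℂ} (hf : f ∈ HardyMinus p) :
    (fun x => f (-x)) ∈ HardyPlus p := by
  obtain ⟨hm, F, hd, ⟨M, hM⟩, ht⟩ := hf
  have hmp : MeasurePreserving (fun x : ℝ => -x) := Measure.measurePreserving_neg volume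
  have hc : ∀ {y : ℝ}, 0 < y → Continuous fun x : ℝ => F (x - y * Complex.I) := fun hy =>
    hd.continuousOn.comp_continuous (by fun_prop) fun x => by simpa using hy
  refine ⟨hm.comp_measurePreserving hmp, fun z => F (-z), ?_, ⟨M, fun y hy => ?_⟩, ?_⟩
  · exact hd.comp differentiable_neg.differentiableOn fun z hz => by simpa using hz
  · refine le_trans (le_of_eq ?_) (hM y hy)
    rw [← eLpNorm_comp_measurePreserving (hc hy).aestronglyMeasurable hmp]
    congr 1
    ext x
    simp only [Function.comp_apply]
    congr 1
    push_cast
    ring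
  · refine ht.congr' ?_
    filter_upwards [self_mem_nhdsWithin] with y hy
    have hs : AEStronglyMeasurable (fun x : ℝ => F (x - y * Complex.I) - f x) volume :=
      (hc hy).aestronglyMeasurable.sub hm.1
    rw [← eLpNorm_comp_measurePreserving hs hmp]
    congr 1
    ext x
    simp only [Function.comp_apply]
    congr 2
    push_cast
    ring

theorem isOpen_upper : IsOpen {z : ℂ | 0 < z.im} := isOpen_lt continuous_const Complex.continuous_im

theorem continuous_line {F : ℂ → ℂ} (hF : DifferentiableOn ℂ F {z : ℂ | 0 < z.im}) {y : ℝ}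
    (hy : 0 < y) : Continuous fun x : ℝ => F (x + y * Complex.I) := by
  refine hF.continuousOn.comp_continuous (by fun_prop) fun x => ?_
  simpa using hy

namespace IsHardy

variable {p q r : ℝ≥0∞} {F G : ℂ → ℂ} {f g : ℝ → ℂ}

theorem aesm (h : IsHardy p F f) {y : ℝ} (hy : 0 < y) :
    AEStronglyMeasurable (fun x : ℝ => F (x + y * Complex.I)) volume :=
  (continuous_line h.diff hy).aestronglyMeasurable

theorem congr (h : IsHardy p F f) (hfg : f =ᵐ[volume] g) : IsHardy p F g where
  memLp := h.memLp.ae_eq hfg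
  diff := h.diff
  bound := h.bound
  tendsto := h.tendsto.congr fun y => eLpNorm_congr_ae <| by
    filter_upwards [hfg] with x hx
    rw [hx]

theorem mul [ENNReal.HolderTriple p q r] (hr : 1 ≤ r) (hF : IsHardy p F f) (hG : IsHardy q G g) :
    IsHardy r (fun z => F z * G z) (fun x => f x * g x) where
  memLp := MemLp.mul' (p := p) (q := q) hG.memLp hF.memLp
  diff := hF.diff.mul hG.diff
  bound := by
    obtain ⟨M, hM⟩ := hF.bound
    obtain ⟨N, hN⟩ := hG.bound
    refine ⟨M * N, fun y hy => ?_⟩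
    refine (eLpNorm_smul_le_mul_eLpNorm (p := p) (q := q) (r := r) (hG.aesm hy) (hF.aesm hy)).trans ?_
    push_cast
    gcongr
    exacts [hM y hy, hN y hy]
  tendsto := by
    obtain ⟨N, hN⟩ := hG.bound
    have hlim : Tendsto (fun y : ℝ =>
        eLpNorm (fun x : ℝ => F (x + y * Complex.I) - f x) p volume * N
        + eLpNorm f p volume * eLpNorm (fun x : ℝ => G (x + y * Complex.I) - g x) q volume)
        (𝓝[>] 0) (𝓝 (0 * N + eLpNorm f p volume * 0)) :=
      (ENNReal.Tendsto.mul_const hF.tendsto (Or.inr ENNReal.coe_ne_top)).add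
        (ENNReal.Tendsto.const_mul hG.tendsto (Or.inr hF.memLp.2.ne))
    rw [zero_mul, mul_zero, add_zero] at hlim
    refine tendsto_of_tendsto_of_tendsto_of_le_of_le' tendsto_const_nhds hlim
      (Eventually.of_forall fun _ => zero_le) ?_
    filter_upwards [self_mem_nhdsWithin] with y hy
    have hy : 0 < y := hy
    have h1 : AEStronglyMeasurable (fun x : ℝ => F (x + y * Complex.I) - f x) volume :=
      (hF.aesm hy).sub hF.memLp.1
    have h2 : AEStronglyMeasurable (fun x : ℝ => G (x + y * Complex.I) - g x) volume :=
      (hG.aesm hy).sub hG.memLp.1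
    have e : (fun x : ℝ => F (x + y * Complex.I) * G (x + y * Complex.I) - f x * g x)
        = ((fun x : ℝ => F (x + y * Complex.I) - f x) • fun x : ℝ => G (x + y * Complex.I))
          + f • fun x : ℝ => G (x + y * Complex.I) - g x := by
      ext x; simp only [Pi.add_apply, Pi.mul_apply, smul_eq_mul]; ring
    rw [e]
    refine (eLpNorm_add_le (h1.smul (hG.aesm hy)) (hF.memLp.1.smul h2) hr).trans ?_
    refine add_le_add ((eLpNorm_smul_le_mul_eLpNorm (p := p) (q := q) (r := r) (hG.aesm hy) h1).trans ?_)
      (eLpNorm_smul_le_mul_eLpNorm (p := p) (q := q) (r := r) h2 hF.memLp.1)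
    gcongr
    exact hN y hy

theorem const_mul (hF : IsHardy p F f) (c : ℂ) :
    IsHardy p (fun z => c * F z) (fun x => c * f x) where
  memLp := hF.memLp.const_mul c
  diff := hF.diff.const_mul c
  bound := by
    obtain ⟨M, hM⟩ := hF.bound
    refine ⟨‖c‖₊ * M, fun y hy => ?_⟩
    refine (eLpNorm_const_smul_le (c := c) (f := fun x : ℝ => F (x + y * Complex.I))).trans ?_
    push_cast
    gcongr
    exacts [le_rfl, hM y hy]
  tendsto := by
    have := ENNReal.Tendsto.const_mul (a := ‖c‖ₑ) hF.tendsto (Or.inr (by simp))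
    rw [mul_zero] at this
    refine this.congr fun y => ?_
    rw [← eLpNorm_const_smul]
    congr 1
    ext x
    simp [mul_sub]

theorem add (hp : 1 ≤ p) (hF : IsHardy p F f) (hG : IsHardy p G g) :
    IsHardy p (fun z => F z + G z) (fun x => f x + g x) where
  memLp := hF.memLp.add hG.memLp
  diff := hF.diff.add hG.diff
  bound := by
    obtain ⟨M, hM⟩ := hF.bound
    obtain ⟨N, hN⟩ := hG.bound
    refine ⟨M + N, fun y hy => ?_⟩
    refine (eLpNorm_add_le (hF.aesm hy) (hG.aesm hy) hp).trans ?_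
    push_cast
    exact add_le_add (hM y hy) (hN y hy)
  tendsto := by
    have hlim := hF.tendsto.add hG.tendsto
    rw [add_zero] at hlim
    refine tendsto_of_tendsto_of_tendsto_of_le_of_le' tendsto_const_nhds hlim
      (Eventually.of_forall fun _ => zero_le) ?_
    filter_upwards [self_mem_nhdsWithin] with y hy
    refine le_trans (le_of_eq ?_) (eLpNorm_add_le ((hF.aesm hy).sub hF.memLp.1)
      ((hG.aesm hy).sub hG.memLp.1) hp)
    congr 1
    ext x
    simp only [Pi.add_apply]
    ring

end IsHardy

/-! ### The weight λ_+ and its inverse powers -/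

theorem lamPlus_ne_zero (x : ℝ) : lamPlus x ≠ 0 := fun h => by
  simpa [lamPlus] using congrArg Complex.im h

theorem lamMinus_ne_zero (x : ℝ) : lamMinus x ≠ 0 := fun h => by
  simpa [lamMinus] using congrArg Complex.im h

theorem continuous_lamPlus : Continuous lamPlus := by unfold lamPlus; fun_prop

theorem norm_lamPlus (x : ℝ) : ‖lamPlus x‖ = √(1 + x ^ 2) := by
  rw [lamPlus, Complex.norm_eq_sqrt_sq_add_sq]
  congr 1
  simp
  ring

theorem one_le_norm_lamPlus (x : ℝ) : 1 ≤ ‖lamPlus x‖ := by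
  rw [norm_lamPlus]
  exact Real.one_le_sqrt.2 (by nlinarith)

theorem norm_lamPlus_le (x : ℝ) {y : ℝ} (hy : 0 ≤ y) :
    ‖lamPlus x‖ ≤ ‖(x : ℂ) + y * Complex.I + Complex.I‖ := by
  rw [norm_lamPlus, Complex.norm_eq_sqrt_sq_add_sq]
  apply Real.sqrt_le_sqrt
  simp
  nlinarith

theorem memLp_inv_lamPlus {t : ℝ≥0∞} (ht : 1 < t) : MemLp (fun x => (lamPlus x)⁻¹) t volume := by
  have hc : AEStronglyMeasurable (fun x => (lamPlus x)⁻¹) volume :=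
    (continuous_lamPlus.inv₀ lamPlus_ne_zero).aestronglyMeasurable
  rcases eq_or_ne t ∞ with rfl | ht'
  · exact memLp_top_of_bound hc 1 (Eventually.of_forall fun x => by
      rw [norm_inv]; exact inv_le_one_of_one_le₀ (one_le_norm_lamPlus x))
  rw [← integrable_norm_rpow_iff hc (by positivity) ht']
  have h1 : 1 < t.toReal := by
    rw [← ENNReal.toReal_one]
    exact (ENNReal.toReal_lt_toReal ENNReal.one_ne_top ht').2 ht
  refine (integrable_rpow_neg_one_add_norm_sq (E := ℝ) (μ := volume) (r := t.toReal)
    (by simpa using h1)).congr (Eventually.of_forall fun x => ?_)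
  have : (0:ℝ) < 1 + x ^ 2 := by positivity
  simp only [norm_inv, norm_lamPlus, Real.norm_eq_abs, sq_abs]
  rw [Real.sqrt_eq_rpow, ← Real.rpow_neg this.le, ← Real.rpow_mul this.le]
  congr 1
  ring

/-- On every horizontal line |z + i|⁻¹ is dominated by its boundary values, and the distance to them
is at most y |λ_+|⁻¹. The case t = ∞ is needed: it makes 1/(z + i) a bounded multiplier. -/
theorem isHardy_inv_add_I {t : ℝ≥0∞} (ht : 1 < t) :
    IsHardy t (fun z => (z + Complex.I)⁻¹) (fun x => (lamPlus x)⁻¹) := by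
  have hm := memLp_inv_lamPlus ht
  have hle : ∀ (x : ℝ) {y : ℝ}, 0 ≤ y →
      ‖((x : ℂ) + y * Complex.I + Complex.I)⁻¹‖ ≤ ‖(lamPlus x)⁻¹‖ := fun x y hy => by
    rw [norm_inv, norm_inv]
    exact inv_anti₀ (norm_pos_iff.2 (lamPlus_ne_zero x)) (norm_lamPlus_le x hy)
  refine ⟨hm, ?_, ?_, ?_⟩
  · refine DifferentiableOn.inv (by fun_prop) fun z hz h => ?_
    have h1 := congrArg Complex.im h
    have h2 : 0 < z.im := hz
    simp at h1
    linarith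
  · refine ⟨(eLpNorm (fun x => (lamPlus x)⁻¹) t volume).toNNReal, fun y hy => ?_⟩
    rw [ENNReal.coe_toNNReal hm.2.ne]
    exact eLpNorm_mono fun x => hle x hy.le
  · have hlim : Tendsto (fun y : ℝ => ENNReal.ofReal y *
        eLpNorm (fun x => (lamPlus x)⁻¹) t volume) (𝓝[>] 0) (𝓝 (ENNReal.ofReal 0 *
        eLpNorm (fun x => (lamPlus x)⁻¹) t volume)) :=
      ENNReal.Tendsto.mul_const (ENNReal.tendsto_ofReal tendsto_id |>.mono_left
        nhdsWithin_le_nhds) (Or.inr hm.2.ne)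
    rw [ENNReal.ofReal_zero, zero_mul] at hlim
    refine tendsto_of_tendsto_of_tendsto_of_le_of_le' tendsto_const_nhds hlim
      (Eventually.of_forall fun _ => zero_le) ?_
    filter_upwards [self_mem_nhdsWithin] with y hy
    have hy : 0 < y := hy
    refine eLpNorm_le_mul_eLpNorm_of_ae_le_mul (Eventually.of_forall fun x => ?_) t
    have h0 : (x : ℂ) + y * Complex.I + Complex.I ≠ 0 := norm_pos_iff.1
      ((norm_pos_iff.2 (lamPlus_ne_zero x)).trans_le (norm_lamPlus_le x hy.le))
    have e : ((x : ℂ) + y * Complex.I + Complex.I)⁻¹ - (lamPlus x)⁻¹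
        = -(y * Complex.I) * ((x : ℂ) + y * Complex.I + Complex.I)⁻¹ * (lamPlus x)⁻¹ := by
      have := lamPlus_ne_zero x
      field_simp
      rw [lamPlus]
      ring
    rw [e, norm_mul, norm_mul]
    have h1 : ‖((x : ℂ) + y * Complex.I + Complex.I)⁻¹‖ ≤ 1 := (hle x hy.le).trans (by
      rw [norm_inv]; exact inv_le_one_of_one_le₀ (one_le_norm_lamPlus x))
    have h2 : ‖-((y : ℂ) * Complex.I)‖ = y := by simp [abs_of_pos hy]
    rw [h2]
    gcongr
    exact mul_le_of_le_one_right hy.le h1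

theorem IsHardy.mul_inv_add_I {p : ℝ≥0∞} (hp : 1 ≤ p) {F : ℂ → ℂ} {f : ℝ → ℂ}
    (h : IsHardy p F f) :
    IsHardy p (fun z => F z * (z + Complex.I)⁻¹) (fun x => f x * (lamPlus x)⁻¹) :=
  IsHardy.mul (q := ∞) hp h (isHardy_inv_add_I (by simp))

theorem IsHardy.mul_inv_add_I_pow {p : ℝ≥0∞} (hp : 1 ≤ p) {F : ℂ → ℂ} {f : ℝ → ℂ}
    (h : IsHardy p F f) (n : ℕ) :
    IsHardy p (fun z => F z * (z + Complex.I)⁻¹ ^ n) (fun x => f x * (lamPlus x)⁻¹ ^ n) := by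
  induction n with
  | zero => simpa using h
  | succ n ih => simpa only [pow_succ, ← mul_assoc] using ih.mul_inv_add_I hp

theorem isHardy_inv_add_I_pow (n : ℕ) :
    IsHardy 1 (fun z => (z + Complex.I)⁻¹ ^ (n + 2)) (fun x => (lamPlus x)⁻¹ ^ (n + 2)) := by
  have h2 := isHardy_inv_add_I (t := 2) (by norm_num)
  have := (IsHardy.mul (r := 1) le_rfl h2 h2).mul_inv_add_I_pow le_rfl n
  simpa only [pow_add, pow_two, mul_comm] using this

/-! ### Fourier transforms of H_1 functions -/

/-- An integrable function with vanishing Fourier transform vanishes. -/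
theorem ae_eq_zero_of_fourier_eq_zero {u : ℝ → ℂ} (hu : Integrable u)
    (h : ∀ w : ℝ, 𝓕 u w = 0) : ∀ᵐ x : ℝ, u x = 0 := by
  refine ae_eq_zero_of_integral_contDiff_smul_eq_zero hu.locallyIntegrable fun g hg hs => ?_
  have hs' : HasCompactSupport (fun x => (g x : ℂ)) := hs.comp_left Complex.ofReal_zero
  have hg' : ContDiff ℝ (⊤ : ℕ∞) (fun x => (g x : ℂ)) := Complex.ofRealCLM.contDiff.comp hg
  set φ : SchwartzMap ℝ ℂ := hs'.toSchwartzMap hg' with hφ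
  -- Writing the test function as 𝓕ψ moves the transform onto u: ∫ 𝓕ψ · u = ∫ ψ · 𝓕u = 0.
  set ψ : SchwartzMap ℝ ℂ := 𝓕⁻ φ with hψ
  have hφ' : ∀ x, 𝓕 (ψ : ℝ → ℂ) x = (g x : ℂ) := fun x => by
    rw [← SchwartzMap.fourier_coe, hψ, FourierTransform.fourier_fourierInv_eq]
    rfl
  have := VectorFourier.integral_fourierIntegral_smul_eq_flip (L := innerₗ ℝ)
      Real.continuous_fourierChar continuous_inner (ψ.integrable (μ := volume)) hu
  have e : ∀ x, g x • u x = (𝓕 (ψ : ℝ → ℂ) x) • u x := fun x => by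
    rw [hφ']; simp
  simp_rw [e]
  refine this.trans ?_
  rw [flip_innerₗ]
  refine integral_eq_zero_of_ae (Eventually.of_forall fun x => ?_)
  have hx : VectorFourier.fourierIntegral Real.fourierChar volume (innerₗ ℝ) u x = 0 := h x
  simp [hx]

theorem continuous_fourier {u : ℝ → ℂ} (hu : Integrable u) : Continuous (𝓕 u) :=
  VectorFourier.fourierIntegral_continuous (L := innerₗ ℝ) Real.continuous_fourierChar
    continuous_inner hu

theorem integrable_fourierChar_smul {u : ℝ → ℂ} (hu : Integrable u) (w : ℝ) :
    Integrable (fun v : ℝ => Real.fourierChar (-(v * w)) • u v) := by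
  have := (VectorFourier.fourierIntegral_convergent_iff (L := innerₗ ℝ)
    Real.continuous_fourierChar continuous_inner w).2 hu
  simpa [mul_comm] using this

theorem fourier_comp_neg (u : ℝ → ℂ) (w : ℝ) : 𝓕 (fun x => u (-x)) w = 𝓕 u (-w) := by
  rw [Real.fourier_real_eq, Real.fourier_real_eq,
    ← integral_neg_eq_self (fun v => Real.fourierChar (-(v * -w)) • u v)]
  simp

/-- The vertical sides of the rectangles vanish, so horizontal integrals agree. -/
theorem integral_line_eq {G : ℂ → ℂ} (hG : DifferentiableOn ℂ G {z : ℂ | 0 < z.im})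
    {M : ℝ≥0∞} (hM : M ≠ ∞)
    (hb : ∀ y : ℝ, 0 < y → eLpNorm (fun x : ℝ => G (x + y * Complex.I)) 1 volume ≤ M)
    {a b : ℝ} (ha : 0 < a) (hab : a ≤ b) :
    ∫ x : ℝ, G (x + a * Complex.I) = ∫ x : ℝ, G (x + b * Complex.I) := by
  have hint : ∀ y : ℝ, 0 < y → Integrable (fun x : ℝ => G (x + y * Complex.I)) := fun y hy => by
    rw [← memLp_one_iff_integrable]
    exact ⟨(continuous_line hG hy).aestronglyMeasurable, (hb y hy).trans_lt hM.lt_top⟩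
  set S : ℝ → ℂ := fun R => ∫ y in a..b, G (R + y * Complex.I) with hS
  have hcont : ContinuousOn (fun p : ℝ × ℝ => G (p.2 + p.1 * Complex.I))
      (Set.Ioc a b ×ˢ Set.univ) := by
    refine hG.continuousOn.comp (by fun_prop) fun p hp => ?_
    have : 0 < p.1 := ha.trans hp.1.1
    simpa using this
  have hae : AEStronglyMeasurable (fun p : ℝ × ℝ => G (p.2 + p.1 * Complex.I))
      ((volume.restrict (Set.Ioc a b)).prod volume) := by
    have := hcont.aestronglyMeasurable (μ := (volume : Measure ℝ).prod volume)
      (measurableSet_Ioc.prod MeasurableSet.univ)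
    rwa [← Measure.prod_restrict, Measure.restrict_univ] at this
  have hprod : Integrable (fun p : ℝ × ℝ => G (p.2 + p.1 * Complex.I))
      ((volume.restrict (Set.Ioc a b)).prod volume) := by
    refine ⟨hae, ?_⟩
    rw [hasFiniteIntegral_iff_enorm, lintegral_prod _ hae.enorm]
    refine lt_of_le_of_lt (b := ∫⁻ _ in Set.Ioc a b, M) ?_ ?_
    · refine setLIntegral_mono measurable_const fun y hy => ?_
      rw [← eLpNorm_one_eq_lintegral_enorm]
      exact hb y (ha.trans hy.1)
    · rw [setLIntegral_const, Real.volume_Ioc]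
      exact ENNReal.mul_lt_top hM.lt_top ENNReal.ofReal_lt_top
  -- G is integrable on the strip, so by Fubini the vertical integral S is integrable in R.
  have hSint : Integrable S := by
    refine hprod.integral_prod_right.congr (Eventually.of_forall fun R => ?_)
    simp only [hS, intervalIntegral.integral_of_le hab]
  have hd : Tendsto (fun R : ℝ => S R - S (-R)) atTop
      (𝓝 (Complex.I * ((∫ x : ℝ, G (x + a * Complex.I)) - ∫ x : ℝ, G (x + b * Complex.I)))) := by
    have h1 := intervalIntegral_tendsto_integral (hint a ha) tendsto_neg_atTop_atBot tendsto_id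
    have h2 := intervalIntegral_tendsto_integral (hint b (ha.trans_le hab))
      tendsto_neg_atTop_atBot tendsto_id
    refine ((h1.sub h2).const_mul Complex.I).congr fun R => ?_
    have h3 := Complex.integral_boundary_rect_eq_zero_of_differentiableOn G
      ((-R : ℝ) + a * Complex.I) (R + b * Complex.I) (hG.mono fun z hz => ?_)
    · simp only [Complex.add_re, Complex.ofReal_re, Complex.mul_re, Complex.I_re, mul_zero,
        Complex.ofReal_im, Complex.I_im, mul_one, sub_self, add_zero, Complex.add_im,
        Complex.mul_im, zero_add, smul_eq_mul] at h3
      simp only [hS, id]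
      set A := ∫ x in -R..R, G (x + a * Complex.I)
      set B := ∫ x in -R..R, G (x + b * Complex.I)
      set C := ∫ y in a..b, G (R + y * Complex.I)
      set D := ∫ y in a..b, G ((-R : ℝ) + y * Complex.I)
      linear_combination Complex.I * h3 - (C - D) * Complex.I_mul_I
    · have := (Complex.mem_reProdIm.1 hz).2
      simp [Set.uIcc_of_le hab] at this
      exact ha.trans_le this.1
  -- By Cauchy's theorem S(R) - S(-R) has a limit; being integrable near infinity, it can only tend
  -- to 0.
  have h0 := IntegrableAtFilter.eq_zero_of_tendsto (μ := volume)
    ((hSint.sub hSint.comp_neg).integrableAtFilter atTop) (fun s hs => ?_) hd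
  · exact sub_eq_zero.1 ((mul_eq_zero.1 h0).resolve_left Complex.I_ne_zero)
  · obtain ⟨c, hc⟩ := mem_atTop_sets.1 hs
    exact measure_mono_top (fun x hx => hc x hx) (Real.volume_Ici (a := c))

/-- For ξ = -2πw > 0, the integral of e^{iξz} F(z) over a horizontal line does not depend on its
height b, yet is O(e^{-ξb}); letting b → ∞ gives 0. -/
theorem IsHardy.fourier_line_eq_zero {F : ℂ → ℂ} {f : ℝ → ℂ} (hF : IsHardy 1 F f) {w : ℝ}
    (hw : w < 0) {y : ℝ} (hy : 0 < y) : 𝓕 (fun x : ℝ => F (x + y * Complex.I)) w = 0 := by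
  obtain ⟨M, hM⟩ := hF.bound
  set ξ : ℝ := -2 * Real.pi * w with hξ
  have hξ0 : 0 < ξ := by
    have := Real.pi_pos
    rw [hξ]
    nlinarith
  set G : ℂ → ℂ := fun z => Complex.exp (ξ * z * Complex.I) * F z with hGdef
  have hG : DifferentiableOn ℂ G {z : ℂ | 0 < z.im} :=
    DifferentiableOn.mul (by fun_prop) hF.diff
  have hnorm : ∀ x y : ℝ, ‖G (x + y * Complex.I)‖
      = Real.exp (-(ξ * y)) * ‖F (x + y * Complex.I)‖ := fun x y => by
    rw [hGdef, norm_mul, Complex.norm_exp]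
    simp
  have hGb : ∀ y : ℝ, 0 < y → eLpNorm (fun x : ℝ => G (x + y * Complex.I)) 1 volume
      ≤ ENNReal.ofReal (Real.exp (-(ξ * y))) * M := fun y hy => by
    refine (eLpNorm_le_mul_eLpNorm_of_ae_le_mul
      (Eventually.of_forall fun x => (hnorm x y).le) 1).trans ?_
    gcongr
    exact hM y hy
  have hconst : ∀ b, y ≤ b →
      ∫ x : ℝ, G (x + y * Complex.I) = ∫ x : ℝ, G (x + b * Complex.I) := fun b hb =>
    integral_line_eq hG (M := M) ENNReal.coe_ne_top (fun t ht => (hGb t ht).trans <| by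
      refine mul_le_of_le_one_left zero_le ?_
      rw [ENNReal.ofReal_le_one, Real.exp_le_one_iff]
      nlinarith [mul_pos hξ0 ht]) hy hb
  have hz : ∫ x : ℝ, G (x + y * Complex.I) = 0 := by
    rw [← enorm_eq_zero]
    have hlim : Tendsto (fun b : ℝ => ENNReal.ofReal (Real.exp (-(ξ * b))) * M) atTop (𝓝 0) := by
      have h1 : Tendsto (fun b : ℝ => Real.exp (-(ξ * b))) atTop (𝓝 0) :=
        Real.tendsto_exp_neg_atTop_nhds_zero.comp (tendsto_id.const_mul_atTop hξ0)
      have := ENNReal.Tendsto.mul_const (b := (M : ℝ≥0∞)) (ENNReal.tendsto_ofReal h1)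
        (Or.inr ENNReal.coe_ne_top)
      simpa using this
    refine le_antisymm (ge_of_tendsto hlim ?_) zero_le
    filter_upwards [eventually_ge_atTop y] with b hb
    rw [hconst b hb]
    refine (enorm_integral_le_lintegral_enorm _).trans ?_
    rw [← eLpNorm_one_eq_lintegral_enorm]
    exact hGb b (hy.trans_le hb)
  rw [Real.fourier_real_eq_integral_exp_smul]
  have e : ∀ x : ℝ, Complex.exp (↑(-2 * Real.pi * x * w) * Complex.I) • F (x + y * Complex.I)
      = Complex.exp (ξ * y) * G (x + y * Complex.I) := fun x => by
    rw [hGdef, smul_eq_mul, ← mul_assoc, ← Complex.exp_add]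
    congr 2
    rw [hξ]
    push_cast
    linear_combination (2 * Real.pi * w * y : ℂ) * Complex.I_mul_I
  simp_rw [e]
  rw [integral_const_mul, hz, mul_zero]

/-- L_1 convergence carries the vanishing to the boundary for w < 0. Continuity of the transform
adds w = 0, which is used later to compare constants. -/
theorem IsHardy.fourier_eq_zero {F : ℂ → ℂ} {f : ℝ → ℂ} (hF : IsHardy 1 F f) {w : ℝ}
    (hw : w ≤ 0) : 𝓕 f w = 0 := by
  have hint : Integrable f := memLp_one_iff_integrable.1 hF.memLp
  have hneg : ∀ w < 0, 𝓕 f w = 0 := fun w hw => by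
    rw [← enorm_eq_zero]
    refine le_antisymm (ge_of_tendsto hF.tendsto ?_) zero_le
    filter_upwards [self_mem_nhdsWithin] with y hy
    have hy : 0 < y := hy
    obtain ⟨M, hM⟩ := hF.bound
    have hi : Integrable (fun x : ℝ => F (x + y * Complex.I)) := by
      rw [← memLp_one_iff_integrable]
      exact ⟨hF.aesm hy, (hM y hy).trans_lt ENNReal.coe_lt_top⟩
    have e : 𝓕 f w = -∫ v : ℝ, Real.fourierChar (-(v * w)) • (F (v + y * Complex.I) - f v) := by
      have h0 := hF.fourier_line_eq_zero hw hy
      rw [Real.fourier_real_eq] at h0 ⊢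
      simp_rw [smul_sub]
      rw [integral_sub, h0, zero_sub, neg_neg]
      · exact integrable_fourierChar_smul hi w
      · exact integrable_fourierChar_smul hint w
    rw [e, enorm_neg, eLpNorm_one_eq_lintegral_enorm]
    refine (enorm_integral_le_lintegral_enorm _).trans (le_of_eq ?_)
    refine lintegral_congr fun v => ?_
    rw [← ofReal_norm, Circle.norm_smul, ofReal_norm]
  rcases hw.lt_or_eq with hw | rfl
  · exact hneg w hw
  · have h1 : Tendsto (𝓕 f) (𝓝[<] 0) (𝓝 (𝓕 f 0)) :=
      (continuous_fourier hint).continuousAt.tendsto.mono_left nhdsWithin_le_nhds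
    refine tendsto_nhds_unique h1 (tendsto_const_nhds.congr' ?_)
    filter_upwards [self_mem_nhdsWithin] with w hw
    exact (hneg w hw).symm

/-! ### Dividing out a zero at i -/

theorem eLpNorm_one_le_add {a b c : ℝ → ℂ} {A B : ℝ} (hb : AEStronglyMeasurable b volume)
    (h : ∀ x, ‖a x‖ ≤ A * ‖b x‖ + B * ‖c x‖) :
    eLpNorm a 1 volume ≤ ENNReal.ofReal A * eLpNorm b 1 volume
      + ENNReal.ofReal B * eLpNorm c 1 volume := by
  simp only [eLpNorm_one_eq_lintegral_enorm]
  rw [← lintegral_const_mul' _ _ ENNReal.ofReal_ne_top,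
    ← lintegral_const_mul' _ _ ENNReal.ofReal_ne_top,
    ← lintegral_add_left' (hb.enorm.const_mul _)]
  refine lintegral_mono fun x => ?_
  simp only [← ofReal_norm]
  rw [← ENNReal.ofReal_mul' (norm_nonneg _), ← ENNReal.ofReal_mul' (norm_nonneg _)]
  exact (ENNReal.ofReal_le_ofReal (h x)).trans ENNReal.ofReal_add_le

/-- Division by a zero at `i` preserves the Hardy space `H_1`. -/
theorem IsHardy.dslope_I {G : ℂ → ℂ} {g : ℝ → ℂ} (h : IsHardy 1 G g) (h0 : G Complex.I = 0) :
    IsHardy 1 (dslope G Complex.I) (fun x => g x * (lamMinus x)⁻¹) := by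
  have hI : {z : ℂ | 0 < z.im} ∈ 𝓝 Complex.I := isOpen_upper.mem_nhds (by simp)
  have hd : DifferentiableOn ℂ (dslope G Complex.I) {z : ℂ | 0 < z.im} :=
    (Complex.differentiableOn_dslope hI).2 h.diff
  have hval : ∀ z, z ≠ Complex.I → dslope G Complex.I z = G z * (z - Complex.I)⁻¹ := fun z hz => by
    rw [dslope_of_ne _ hz, slope_def_module, h0, sub_zero, smul_eq_mul, mul_comm]
  have hlam : ∀ x, ‖(lamMinus x)⁻¹‖ ≤ 1 := fun x => by
    rw [norm_inv]
    refine inv_le_one_of_one_le₀ ?_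
    have := Complex.abs_im_le_norm (lamMinus x)
    simpa [lamMinus] using this
  have hc : Continuous fun x => (lamMinus x)⁻¹ :=
    Continuous.inv₀ (by unfold lamMinus; fun_prop) lamMinus_ne_zero
  refine ⟨?_, hd, ?_, ?_⟩
  · refine h.memLp.of_le (h.memLp.1.mul hc.aestronglyMeasurable) (Eventually.of_forall fun x => ?_)
    rw [norm_mul]
    exact mul_le_of_le_one_right (norm_nonneg _) (hlam x)
  · obtain ⟨M, hM⟩ := h.bound
    -- Inside this disc compactness bounds the quotient by K; outside it |z - i|⁻¹ ≤ 2. A horizontal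
    -- line meets the disc only for x in [-1, 1], whence the indicator.
    have hsub : Metric.closedBall Complex.I (1 / 2) ⊆ {z : ℂ | 0 < z.im} := fun z hz => by
      have h1 := (Complex.abs_im_le_norm (z - Complex.I)).trans (mem_closedBall_iff_norm.1 hz)
      rw [Complex.sub_im, Complex.I_im, abs_le] at h1
      show 0 < z.im
      linarith
    obtain ⟨K, hK⟩ := (isCompact_closedBall Complex.I (1 / 2)).exists_bound_of_continuousOn
      (hd.continuousOn.mono hsub)
    have hind : MemLp (Set.indicator (Set.Icc (-1 : ℝ) 1) fun _ => (1 : ℂ)) 1 volume :=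
      memLp_indicator_const 1 measurableSet_Icc 1 (Or.inr (by simp))
    refine ⟨(ENNReal.ofReal 2 * M + ENNReal.ofReal K *
      eLpNorm (Set.indicator (Set.Icc (-1 : ℝ) 1) fun _ => (1 : ℂ)) 1 volume).toNNReal,
      fun y hy => ?_⟩
    rw [ENNReal.coe_toNNReal]
    swap
    · exact ENNReal.add_ne_top.2 ⟨ENNReal.mul_ne_top ENNReal.ofReal_ne_top ENNReal.coe_ne_top,
        ENNReal.mul_ne_top ENNReal.ofReal_ne_top hind.2.ne⟩
    refine (eLpNorm_one_le_add (A := 2) (B := K)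
      (c := Set.indicator (Set.Icc (-1 : ℝ) 1) fun _ => (1 : ℂ)) (h.aesm hy) fun x => ?_).trans ?_
    · set z : ℂ := x + y * Complex.I with hz
      by_cases hball : ‖z - Complex.I‖ ≤ 1 / 2
      · have hx : x ∈ Set.Icc (-1 : ℝ) 1 := by
          have h1 := (Complex.abs_re_le_norm (z - Complex.I)).trans hball
          simp [hz, abs_le] at h1
          constructor <;> linarith [h1.1, h1.2]
        rw [Set.indicator_of_mem hx, norm_one, mul_one]
        exact (hK z (mem_closedBall_iff_norm.2 hball)).trans
          (le_add_of_nonneg_left (by positivity))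
      · push Not at hball
        have hne : z - Complex.I ≠ 0 := norm_pos_iff.1 (by linarith)
        rw [hval z (sub_ne_zero.1 hne), norm_mul, norm_inv]
        have h2 : ‖z - Complex.I‖⁻¹ ≤ 2 := by
          rw [inv_le_comm₀ (by linarith) (by norm_num)]
          linarith
        have hK0 : 0 ≤ K := (norm_nonneg _).trans (hK Complex.I (by simp))
        have h3 := mul_le_mul_of_nonneg_left h2 (norm_nonneg (G z))
        have h4 : 0 ≤ K * ‖(Set.indicator (Set.Icc (-1 : ℝ) 1) fun _ => (1 : ℂ)) x‖ := by
          positivity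
        linarith
    · gcongr
      exact hM y hy
  · have hlim : Tendsto (fun y : ℝ => ENNReal.ofReal 2 *
        eLpNorm (fun x : ℝ => G (x + y * Complex.I) - g x) 1 volume
        + ENNReal.ofReal (2 * y) * eLpNorm g 1 volume) (𝓝[>] 0)
        (𝓝 (ENNReal.ofReal 2 * 0 + ENNReal.ofReal (2 * 0) * eLpNorm g 1 volume)) := by
      refine (ENNReal.Tendsto.const_mul h.tendsto (Or.inr ENNReal.ofReal_ne_top)).add
        (ENNReal.Tendsto.mul_const (ENNReal.tendsto_ofReal ?_) (Or.inr h.memLp.2.ne))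
      exact (tendsto_id.const_mul 2).mono_left nhdsWithin_le_nhds
    rw [mul_zero, mul_zero, ENNReal.ofReal_zero, zero_mul, add_zero] at hlim
    refine tendsto_of_tendsto_of_tendsto_of_le_of_le' tendsto_const_nhds hlim
      (Eventually.of_forall fun _ => zero_le) ?_
    -- Lines of height below 1/2 stay at distance at least 1/2 from i.
    filter_upwards [Ioo_mem_nhdsGT (show (0 : ℝ) < 1 / 2 by norm_num)] with y hy
    refine eLpNorm_one_le_add ((h.aesm hy.1).sub h.memLp.1) fun x => ?_
    set z : ℂ := x + y * Complex.I with hz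
    have hn : 1 / 2 ≤ ‖z - Complex.I‖ := by
      have h1 := Complex.abs_im_le_norm (z - Complex.I)
      have h2 : (z - Complex.I).im = y - 1 := by simp [hz]
      rw [h2, abs_of_neg (by linarith [hy.2])] at h1
      linarith [hy.2]
    have hne : z - Complex.I ≠ 0 := norm_pos_iff.1 (by linarith)
    have hinv : ‖(z - Complex.I)⁻¹‖ ≤ 2 := by
      rw [norm_inv, inv_le_comm₀ (by linarith) (by norm_num)]
      linarith
    have e : dslope G Complex.I z - g x * (lamMinus x)⁻¹
        = (z - Complex.I)⁻¹ * (G z - g x)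
          + -(y * Complex.I) * ((z - Complex.I)⁻¹ * (lamMinus x)⁻¹) * g x := by
      rw [hval z (sub_ne_zero.1 hne)]
      have := lamMinus_ne_zero x
      field_simp
      rw [hz, lamMinus]
      ring
    rw [e]
    refine (norm_add_le _ _).trans (add_le_add ?_ ?_)
    · rw [norm_mul]
      gcongr
    · rw [norm_mul, norm_mul, norm_mul, norm_neg, norm_mul, Complex.norm_I, mul_one,
        Complex.norm_real, Real.norm_eq_abs, abs_of_pos hy.1, mul_comm (2 : ℝ) y]
      have := mul_le_mul hinv (hlam x) (norm_nonneg _) (by norm_num)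
      rw [mul_one] at this
      have hy0 := hy.1.le
      gcongr

/-- The Hardy class `H_1`, divided by `(x + i)^N` and with a suitable constant subtracted, contains
the quotient by `x - i`. -/
theorem IsHardy.exists_sub_div {F : ℂ → ℂ} {f : ℝ → ℂ} {m : ℕ}
    (h : IsHardy 1 F (fun x => f x * (lamPlus x)⁻¹ ^ (m + 2))) :
    ∃ c : ℂ, ∃ G : ℂ → ℂ,
      IsHardy 1 G (fun x => (f x - c) * (lamMinus x)⁻¹ * (lamPlus x)⁻¹ ^ (m + 1)) := by
  -- F(z)(z + i)^{m+2} is the holomorphic extension of f, and c is its value at i.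
  set c : ℂ := F Complex.I * (2 * Complex.I) ^ (m + 2) with hc
  have h1 := h.add le_rfl ((isHardy_inv_add_I_pow m).const_mul (-c))
  have h0 : F Complex.I + -c * (Complex.I + Complex.I)⁻¹ ^ (m + 2) = 0 := by
    have : Complex.I + Complex.I ≠ 0 := by simp [← two_mul]
    rw [hc, two_mul, inv_pow]
    field_simp
    ring
  -- Multiplication by (z + i)/(z - i) = 1 + 2i/(z - i) removes the zero and one power of z + i at
  -- once.
  refine ⟨c, _, (h1.add le_rfl ((h1.dslope_I h0).const_mul (2 * Complex.I))).congr
    (Eventually.of_forall fun x => ?_)⟩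
  have hp := lamPlus_ne_zero x
  have hm := lamMinus_ne_zero x
  have e : lamPlus x = lamMinus x + 2 * Complex.I := by rw [lamPlus, lamMinus]; ring
  have e2 : lamPlus x * (lamMinus x)⁻¹ = 1 + 2 * Complex.I * (lamMinus x)⁻¹ := by
    rw [e]
    field_simp
  have e3 : (lamPlus x)⁻¹ ^ (m + 1) = lamPlus x * (lamPlus x)⁻¹ ^ (m + 2) := by
    rw [pow_succ _ (m + 1)]
    field_simp
  simp only
  rw [e3]
  linear_combination (-(f x - c) * (lamPlus x)⁻¹ ^ (m + 2)) * e2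

/-! ### Liouville theorem -/

theorem lamPlus_neg (x : ℝ) : lamPlus (-x) = -lamMinus x := by
  rw [lamPlus, lamMinus]; push_cast; ring

theorem lamMinus_neg (x : ℝ) : lamMinus (-x) = -lamPlus x := by
  rw [lamPlus, lamMinus]; push_cast; ring

theorem lamMinus_mul_lamPlus (x : ℝ) : lamMinus x * lamPlus x = ((1 + x ^ 2 : ℝ) : ℂ) := by
  rw [lamPlus, lamMinus]; push_cast; linear_combination -Complex.I_sq

theorem integral_inv_lamMinus_mul_inv_lamPlus :
    ∫ x : ℝ, (lamMinus x)⁻¹ * (lamPlus x)⁻¹ = Real.pi := by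
  rw [← integral_univ_inv_one_add_sq, ← integral_complex_ofReal]
  congr 1
  ext x
  rw [← mul_inv, lamMinus_mul_lamPlus]
  push_cast
  rfl

theorem ae_comp_neg {P : ℝ → Prop} (h : ∀ᵐ x : ℝ, P x) : ∀ᵐ x : ℝ, P (-x) :=
  (Measure.measurePreserving_neg (volume : Measure ℝ)).quasiMeasurePreserving.ae h

open Polynomial in
/-- Liouville theorem: a function of polynomial growth, in the `H_1` sense, from both sides is a
polynomial. -/
theorem exists_polynomial (m : ℕ) : ∀ (f : ℝ → ℂ),
    (∃ F, IsHardy 1 F (fun x => f x * (lamPlus x)⁻¹ ^ (m + 1))) →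
    (∃ F, IsHardy 1 F (fun x => f (-x) * (lamPlus x)⁻¹ ^ (m + 1))) →
    ∃ P : ℂ[X], ∀ᵐ x : ℝ, f x = P.eval (x : ℂ) := by
  induction m with
  | zero =>
    rintro f ⟨F, hF⟩ ⟨F', hF'⟩
    have hup : ∀ {f : ℝ → ℂ} {F : ℂ → ℂ}, IsHardy 1 F (fun x => f x * (lamPlus x)⁻¹ ^ (0 + 1)) →
        ∃ c : ℂ, ∃ G : ℂ → ℂ, IsHardy 1 G (fun x => (f x - c) * ((lamMinus x)⁻¹ * (lamPlus x)⁻¹)) :=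
      fun {f F} hF => by
        obtain ⟨c, G, hG⟩ := IsHardy.exists_sub_div (f := f) (m := 0)
          ((hF.mul_inv_add_I le_rfl).congr (Eventually.of_forall fun x => by ring))
        exact ⟨c, G, hG.congr (Eventually.of_forall fun x => by ring)⟩
    obtain ⟨c, G, hG⟩ := hup hF
    obtain ⟨c', G', hG'⟩ := hup (f := fun x => f (-x)) hF'
    have hi : Integrable fun x => (f x - c) * ((lamMinus x)⁻¹ * (lamPlus x)⁻¹) :=
      memLp_one_iff_integrable.1 hG.memLp
    set V : ℝ → ℂ := fun x => (f x - c') * ((lamMinus x)⁻¹ * (lamPlus x)⁻¹) with hV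
    have hG'' : IsHardy 1 G' (fun x => V (-x)) := hG'.congr (Eventually.of_forall fun x => by
      simp only [hV, lamPlus_neg, lamMinus_neg, inv_neg]
      ring)
    have hVi : Integrable V := by
      simpa using (memLp_one_iff_integrable.1 hG''.memLp).comp_neg
    have hV0 : ∀ w : ℝ, 0 ≤ w → 𝓕 V w = 0 := fun w hw => by
      have := hG''.fourier_eq_zero (neg_nonpos.2 hw)
      rwa [fourier_comp_neg, neg_neg] at this
    -- Both quotients have integral 0, being transforms at w = 0, and they differ by (c' - c)/(1 +
    -- x²), whose integral is (c' - c)π.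
    have hcc : c = c' := by
      have h1 := hG.fourier_eq_zero le_rfl
      have h2 := hV0 0 le_rfl
      rw [Real.fourier_real_eq] at h1 h2
      simp only [mul_zero, neg_zero, AddChar.map_zero_eq_one, one_smul] at h1 h2
      have h3 := integral_sub hi hVi
      rw [h1, h2, sub_zero] at h3
      have e : ∀ x, (f x - c) * ((lamMinus x)⁻¹ * (lamPlus x)⁻¹) - V x
          = (c' - c) * ((lamMinus x)⁻¹ * (lamPlus x)⁻¹) := fun x => by rw [hV]; ring
      simp_rw [e] at h3
      rw [integral_const_mul, integral_inv_lamMinus_mul_inv_lamPlus] at h3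
      have := (mul_eq_zero.1 h3).resolve_right (by exact_mod_cast Real.pi_ne_zero)
      exact (sub_eq_zero.1 this).symm
    refine ⟨C c, ?_⟩
    have hz := ae_eq_zero_of_fourier_eq_zero hi fun w => by
      rcases le_total w 0 with hw | hw
      · exact hG.fourier_eq_zero hw
      · rw [hcc]
        exact hV0 w hw
    filter_upwards [hz] with x hx
    have hne : (lamMinus x)⁻¹ * (lamPlus x)⁻¹ ≠ 0 :=
      mul_ne_zero (inv_ne_zero (lamMinus_ne_zero x)) (inv_ne_zero (lamPlus_ne_zero x))
    rw [eval_C]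
    exact sub_eq_zero.1 ((mul_eq_zero.1 hx).resolve_right hne)
  | succ m ih =>
    rintro f ⟨F, hF⟩ ⟨F', hF'⟩
    obtain ⟨c, G, hG⟩ := hF.exists_sub_div
    -- From below, x - i has no zero; after reflection it is -λ_+, so dividing by it already uses up
    -- one power.
    obtain ⟨P, hP⟩ := ih (fun x => (f x - c) * (lamMinus x)⁻¹) ⟨G, hG⟩
      ⟨_, ((hF'.add le_rfl ((isHardy_inv_add_I_pow m).const_mul (-c))).const_mul (-1)).congr
        (Eventually.of_forall fun x => by
          simp only [lamMinus_neg, inv_neg]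
          ring)⟩
    refine ⟨P * (X - C Complex.I) + C c, ?_⟩
    filter_upwards [hP] with x hx
    have hm := lamMinus_ne_zero x
    rw [eval_add, eval_mul, ← hx, eval_sub, eval_X, eval_C, eval_C]
    change _ = _ * (lamMinus x) + c
    field_simp
    ring

/-! ### Growth of polynomials and Hölder exponents -/

section
open Polynomial

theorem exists_le_norm_eval {P : ℂ[X]} (hP : P ≠ 0) :
    ∃ ε > 0, ∀ᶠ x : ℝ in atTop, ε ≤ ‖P.eval (x : ℂ)‖ := by
  by_cases hd : 0 < P.degree
  · have hz : Tendsto (fun x : ℝ => ‖(x : ℂ)‖) atTop atTop := by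
      simpa using tendsto_abs_atTop_atTop
    exact ⟨1, one_pos, (P.tendsto_norm_atTop hd hz).eventually_ge_atTop 1⟩
  · rw [eq_C_of_degree_le_zero (not_lt.1 hd)] at hP ⊢
    refine ⟨‖P.coeff 0‖, norm_pos_iff.2 fun h => hP (by rw [h, C_0]), ?_⟩
    simp

theorem not_memLp_of_eventually_le {φ : ℝ → ℂ} {R : ℝ≥0∞} (h0 : R ≠ 0) (h1 : R ≠ ∞) {ε : ℝ}
    (hε : 0 < ε) (h : ∀ᶠ x in atTop, ε ≤ ‖φ x‖) : ¬ MemLp φ R volume := fun hφ => by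
  have := hφ.meas_ge_lt_top' h0 h1 (ε := ENNReal.ofReal ε) (by simpa using hε)
  obtain ⟨c, hc⟩ := eventually_atTop.1 h
  refine this.ne (measure_mono_top (fun x hx => ?_) (Real.volume_Ici (a := c)))
  have := ENNReal.ofReal_le_ofReal (hc x hx)
  rwa [ofReal_norm] at this

theorem not_memLp_one_of_eventually_le {φ : ℝ → ℂ} {ε : ℝ}
    (hε : 0 < ε) (h : ∀ᶠ x in atTop, ε ≤ ‖φ x‖ * ‖lamPlus x‖) : ¬ MemLp φ 1 volume := fun hφ => by
  obtain ⟨c, hc⟩ := eventually_atTop.1 (h.and (eventually_ge_atTop 1))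
  refine not_integrableOn_Ioi_inv (a := c) ?_
  have hi : Integrable (fun x => (2 / ε) * ‖φ x‖) (volume.restrict (Set.Ioi c)) :=
    ((memLp_one_iff_integrable.1 hφ).norm.const_mul _).integrableOn
  refine hi.mono' measurable_inv.aestronglyMeasurable ?_
  filter_upwards [ae_restrict_mem measurableSet_Ioi] with x hx
  obtain ⟨h1, h2⟩ := hc x (le_of_lt hx)
  have h3 : ‖lamPlus x‖ ≤ 2 * x := by
    rw [norm_lamPlus]
    exact Real.sqrt_le_iff.2 ⟨by linarith, by nlinarith⟩
  have h4 : ε ≤ ‖φ x‖ * (2 * x) := h1.trans (by gcongr)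
  have hx0 : 0 < x := by linarith
  rw [Real.norm_eq_abs, abs_of_pos (inv_pos.2 hx0), inv_le_iff_one_le_mul₀ hx0, div_mul_eq_mul_div,
    div_mul_eq_mul_div, one_le_div hε]
  linarith

theorem polynomial_eq_of_ae_eq {P Q : ℂ[X]}
    (h : ∀ᵐ x : ℝ, P.eval (x : ℂ) = Q.eval (x : ℂ)) : P = Q := by
  have h1 : (fun x : ℝ => P.eval (x : ℂ)) = fun x : ℝ => Q.eval (x : ℂ) :=
    Measure.eq_of_ae_eq h (P.continuous.comp Complex.continuous_ofReal)
      (Q.continuous.comp Complex.continuous_ofReal)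
  refine eq_of_infinite_eval_eq P Q ((Set.infinite_range_of_injective
    Complex.ofReal_injective).mono ?_)
  rintro _ ⟨x, rfl⟩
  exact congrFun h1 x

/-- The Hölder exponent of a product, in terms of reciprocals. -/
theorem ofReal_inv_add_inv {a b : ℝ} (ha : 1 < a) (hb : 1 < b) :
    (ENNReal.ofReal a)⁻¹ + (ENNReal.ofReal b)⁻¹ = ENNReal.ofReal (1 / a + 1 / b) := by
  rw [← ENNReal.ofReal_inv_of_pos (by linarith), ← ENNReal.ofReal_inv_of_pos (by linarith),
    ← ENNReal.ofReal_add (by positivity) (by positivity), one_div, one_div]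

/-- The exponent `q` with `1/q = 1/a + 1/b`. -/
noncomputable def prodExp (a b : ℝ) : ℝ≥0∞ := (ENNReal.ofReal (1 / a + 1 / b))⁻¹

theorem holderTriple_prodExp {a b : ℝ} (ha : 1 < a) (hb : 1 < b) :
    ENNReal.HolderTriple (ENNReal.ofReal a) (ENNReal.ofReal b) (prodExp a b) :=
  ⟨by rw [prodExp, inv_inv, ofReal_inv_add_inv ha hb]⟩

theorem prodExp_ne_top {a b : ℝ} (ha : 1 < a) (hb : 1 < b) : prodExp a b ≠ ∞ := by
  have : 0 < 1 / a + 1 / b := by positivity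
  simpa [prodExp] using this

theorem one_le_prodExp {a b : ℝ} (hab : 1 / a + 1 / b ≤ 1) : 1 ≤ prodExp a b := by
  rw [prodExp, ENNReal.one_le_inv, ENNReal.ofReal_le_one]
  exact hab

theorem one_lt_prodExp {a b : ℝ} (hab : 1 / a + 1 / b < 1) : 1 < prodExp a b := by
  rw [prodExp, ENNReal.one_lt_inv, ENNReal.ofReal_lt_one]
  exact hab

theorem exists_isHardy_mul {a b : ℝ} (ha : 1 < a) (hb : 1 < b) (hab : 1 / a + 1 / b ≤ 1)
    {f g : ℝ → ℂ} (hf : f ∈ HardyPlus a) (hg : g ∈ HardyPlus b) (n : ℕ) :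
    ∃ F, IsHardy 1 F (fun x => f x * g x * (lamPlus x)⁻¹ ^ (n + 1)) := by
  obtain ⟨F, hF⟩ := mem_hardyPlus_iff.1 hf
  obtain ⟨G, hG⟩ := mem_hardyPlus_iff.1 hg
  have := holderTriple_prodExp ha hb
  have hFG := hF.mul (one_le_prodExp hab) hG
  -- T is the exponent conjugate to `prodExp a b`. It exceeds 1 because the latter is finite, so one
  -- factor 1/(z + i) brings the product into H_1.
  set T : ℝ≥0∞ := (1 - (prodExp a b)⁻¹)⁻¹ with hT
  have hR : (prodExp a b)⁻¹ ≤ 1 := ENNReal.inv_le_one.2 (one_le_prodExp hab)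
  have : ENNReal.HolderTriple (prodExp a b) T 1 :=
    ⟨by rw [hT, inv_inv, add_tsub_cancel_of_le hR, inv_one]⟩
  have hT1 : 1 < T := by
    rw [hT, ENNReal.one_lt_inv]
    exact ENNReal.sub_lt_self ENNReal.one_ne_top one_ne_zero
      (ENNReal.inv_ne_zero.2 (prodExp_ne_top ha hb))
  exact ⟨_, ((hFG.mul le_rfl (isHardy_inv_add_I hT1)).mul_inv_add_I_pow le_rfl n).congr
    (Eventually.of_forall fun x => by ring)⟩

/-! ### Quotients of two factorizations -/

namespace IsFactorization

variable {j s : ℝ} {g gm gp gm' gp' : ℝ → ℂ} {k : ℤ} {n : ℕ}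

theorem ae_quotient_eq (h : IsFactorization j s g (k + n) gm gp)
    (h' : IsFactorization j s g k gm' gp') :
    ∀ᵐ x : ℝ, gp x * (gp' x)⁻¹ * (lamPlus x)⁻¹ ^ n = gm' x * (gm x)⁻¹ * (lamMinus x)⁻¹ ^ n := by
  filter_upwards [h.minus_ne_zero, h'.plus_ne_zero, h.eq_mul, h'.eq_mul] with x hm hp e e'
  have h1 := lamPlus_ne_zero x
  have h2 := lamMinus_ne_zero x
  have hr : r x ≠ 0 := div_ne_zero h2 h1
  rw [e, zpow_add₀ hr, zpow_natCast] at e'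
  have hk : r x ^ k ≠ 0 := zpow_ne_zero k hr
  have e2 : gm x * r x ^ n * gp x = gm' x * gp' x :=
    mul_left_cancel₀ hk (by linear_combination e')
  rw [r, div_pow] at e2
  rw [inv_pow, inv_pow]
  field_simp at e2 ⊢
  linear_combination e2

theorem exists_polynomial_quotient (h : IsFactorization j s g (k + n) gm gp)
    (h' : IsFactorization j s g k gm' gp') :
    ∃ P : ℂ[X], ∀ᵐ x : ℝ, gp x * (gp' x)⁻¹ = P.eval (x : ℂ) * lamPlus x ^ n ∧
      gm' x * (gm x)⁻¹ = P.eval (x : ℂ) * lamMinus x ^ n := by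
  have hq := h.ae_quotient_eq h'
  have hup : ∃ F, IsHardy 1 F
      (fun x => gp x * (gp' x)⁻¹ * (lamPlus x)⁻¹ ^ n * (lamPlus x)⁻¹ ^ (2 + 1)) := by
    obtain ⟨F, hF⟩ := exists_isHardy_mul h.one_lt_s h.one_lt_j
      (by linarith [h.inv_add_inv_le]) h.plus_mem h'.plus_inv_mem n
    exact ⟨F, hF.congr (Eventually.of_forall fun x => by ring)⟩
  have hlow : ∃ F, IsHardy 1 F (fun x =>
      gp (-x) * (gp' (-x))⁻¹ * (lamPlus (-x))⁻¹ ^ n * (lamPlus x)⁻¹ ^ (2 + 1)) := by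
    obtain ⟨F, hF⟩ := exists_isHardy_mul h.one_lt_j h.one_lt_s h.inv_add_inv_le
      (comp_neg_mem_hardyPlus h'.minus_mem) (comp_neg_mem_hardyPlus h.minus_inv_mem) n
    refine ⟨_, (hF.const_mul ((-1) ^ n)).congr ?_⟩
    filter_upwards [ae_comp_neg hq] with x hx
    rw [hx]
    simp only [lamMinus_neg, inv_neg, neg_pow (lamPlus x)⁻¹ n]
    ring
  obtain ⟨P, hP⟩ := exists_polynomial 2 _ hup hlow
  refine ⟨P, ?_⟩
  filter_upwards [hP, hq] with x hx hqx
  rw [← hx]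
  refine ⟨?_, ?_⟩
  · rw [inv_pow, inv_mul_cancel_right₀ (pow_ne_zero n (lamPlus_ne_zero x))]
  · rw [hqx, inv_pow, inv_mul_cancel_right₀ (pow_ne_zero n (lamMinus_ne_zero x))]

theorem memLp_quotient {a : ℝ} (ha : 1 < a) (h' : IsFactorization j s g k gm' gp')
    (hp : gp ∈ CalHPlus a) {P : ℂ[X]}
    (hP : ∀ᵐ x : ℝ, gp x * (gp' x)⁻¹ = P.eval (x : ℂ) * lamPlus x ^ n) :
    MemLp (fun x : ℝ => P.eval (x : ℂ) * lamPlus x ^ n * (lamPlus x)⁻¹ ^ 2) (prodExp a j) volume := by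
  have := holderTriple_prodExp ha h'.one_lt_j
  refine (MemLp.mul' (r := prodExp a j) h'.plus_inv_mem.1 hp.1).ae_eq ?_
  filter_upwards [hP] with x hx
  rw [← hx]
  ring

theorem polynomial_ne_zero (h : IsFactorization j s g (k + n) gm gp)
    (h' : IsFactorization j s g k gm' gp') {P : ℂ[X]}
    (hP : ∀ᵐ x : ℝ, gp x * (gp' x)⁻¹ = P.eval (x : ℂ) * lamPlus x ^ n) : P ≠ 0 := by
  rintro rfl
  obtain ⟨x, h1, h2, h3⟩ := (hP.and (h.plus_ne_zero.and h'.plus_ne_zero)).exists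
  rw [eval_zero, zero_mul] at h1
  exact mul_ne_zero h2 (inv_ne_zero h3) h1

theorem exists_const (h : IsFactorization j s g k gm gp) (h' : IsFactorization j s g k gm' gp') :
    ∃ c : ℂ, c ≠ 0 ∧ (∀ᵐ x : ℝ, gp x * (gp' x)⁻¹ = c) ∧ ∀ᵐ x : ℝ, gm' x * (gm x)⁻¹ = c := by
  have e : k = k + (0 : ℕ) := by simp
  rw [e] at h
  obtain ⟨P, hP⟩ := h.exists_polynomial_quotient h'
  have hP0 := h.polynomial_ne_zero h' (hP.mono fun x hx => hx.1)
  rw [← e] at h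
  rw [e] at h'
  obtain ⟨Q, hQ⟩ := h'.exists_polynomial_quotient h
  have hPQ : P * Q = 1 := by
    refine polynomial_eq_of_ae_eq ?_
    filter_upwards [hP, hQ, h.plus_ne_zero, h'.plus_ne_zero] with x h1 h2 h3 h4
    have h5 := h1.1
    have h6 := h2.1
    rw [pow_zero, mul_one] at h5 h6
    rw [eval_mul, ← h5, ← h6, eval_one]
    field_simp
  obtain ⟨c, hc, rfl⟩ := isUnit_iff.1 (IsUnit.of_mul_eq_one Q hPQ)
  refine ⟨c, hc.ne_zero, ?_, ?_⟩
  · filter_upwards [hP] with x hx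
    simpa using hx.1
  · filter_upwards [hP] with x hx
    simpa using hx.2

theorem index_eq_of_conjugate {j' : ℝ} (hj' : 1 / j + 1 / j' = 1)
    (h : IsFactorization j s g (k + n) gm gp) (h' : IsFactorization j s g k gm' gp')
    (hp : gp ∈ CalHPlus j') : n = 0 := by
  by_contra hn
  obtain ⟨m, rfl⟩ := Nat.exists_eq_succ_of_ne_zero hn
  have hj : 1 < j := h.one_lt_j
  have h1 : 0 < 1 / j ∧ 1 / j < 1 :=
    ⟨by positivity, by rw [div_lt_one (by linarith)]; exact hj⟩
  have hj1 : 1 < j' := by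
    have h0 : 0 < 1 / j' := by linarith
    have h2 : 0 < j' := one_div_pos.1 h0
    rw [← one_div_lt_one_div h2 one_pos]
    linarith
  obtain ⟨P, hP⟩ := h.exists_polynomial_quotient h'
  have hP1 := hP.mono fun x hx => hx.1
  have hP0 := h.polynomial_ne_zero h' hP1
  have hL := memLp_quotient hj1 h' hp hP1
  have hR : prodExp j' j = 1 := by
    rw [prodExp, add_comm, hj', ENNReal.ofReal_one, inv_one]
  rw [hR] at hL
  obtain ⟨ε, hε, hev⟩ := exists_le_norm_eval hP0
  refine not_memLp_one_of_eventually_le hε ?_ hL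
  filter_upwards [hev] with x hx
  have h3 := lamPlus_ne_zero x
  have e : P.eval (x : ℂ) * lamPlus x ^ (m + 1) * (lamPlus x)⁻¹ ^ 2 * lamPlus x
      = P.eval (x : ℂ) * lamPlus x ^ m := by
    field_simp
    ring
  rw [← norm_mul, e, norm_mul, norm_pow]
  exact hx.trans (le_mul_of_one_le_right (norm_nonneg _) (one_le_pow₀ (one_le_norm_lamPlus x)))

theorem index_le_one (h : IsFactorization j s g (k + n) gm gp)
    (h' : IsFactorization j s g k gm' gp') : n ≤ 1 := by
  by_contra! hn
  obtain ⟨m, rfl⟩ := Nat.exists_eq_add_of_le' hn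
  obtain ⟨P, hP⟩ := h.exists_polynomial_quotient h'
  have hP1 := hP.mono fun x hx => hx.1
  have hP0 := h.polynomial_ne_zero h' hP1
  have hL := memLp_quotient h.one_lt_s h' h.plus_mem hP1
  obtain ⟨ε, hε, hev⟩ := exists_le_norm_eval hP0
  have hab : 1 / s + 1 / j ≤ 1 := by linarith [h.inv_add_inv_le]
  refine not_memLp_of_eventually_le (one_pos.trans_le (one_le_prodExp hab)).ne'
    (prodExp_ne_top h.one_lt_s h.one_lt_j) hε ?_ hL
  filter_upwards [hev] with x hx
  have h3 := lamPlus_ne_zero x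
  have e : P.eval (x : ℂ) * lamPlus x ^ (m + 2) * (lamPlus x)⁻¹ ^ 2
      = P.eval (x : ℂ) * lamPlus x ^ m := by
    field_simp
    ring
  rw [e, norm_mul, norm_pow]
  exact hx.trans (le_mul_of_one_le_right (norm_nonneg _) (one_le_pow₀ (one_le_norm_lamPlus x)))

theorem exists_const_of_index_one (hjs : 1 / j + 1 / s < 1)
    (h : IsFactorization j s g (k + 1) gm gp) (h' : IsFactorization j s g k gm' gp') :
    ∃ c : ℂ, c ≠ 0 ∧ (∀ᵐ x : ℝ, gp x * (gp' x)⁻¹ = c * lamPlus x) ∧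
      ∀ᵐ x : ℝ, gm' x * (gm x)⁻¹ = c * lamMinus x := by
  have h1 : IsFactorization j s g (k + (1 : ℕ)) gm gp := by simpa using h
  obtain ⟨P, hP⟩ := h1.exists_polynomial_quotient h'
  have hP1 := hP.mono fun x hx => hx.1
  have hP0 := h1.polynomial_ne_zero h' hP1
  have hL := memLp_quotient h.one_lt_s h' h.plus_mem hP1
  have hab : 1 / s + 1 / j < 1 := by linarith
  have hR := one_lt_prodExp hab
  obtain ⟨Q, c, rfl⟩ : ∃ (Q : ℂ[X]) (c : ℂ), P = (X - C (-Complex.I)) * Q + C c :=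
    ⟨P /ₘ (X - C (-Complex.I)), P.eval (-Complex.I), by
      rw [← modByMonic_X_sub_C_eq_C_eval, add_comm, modByMonic_add_div]⟩
  have hQ : Q = 0 := by
    by_contra hQ
    obtain ⟨ε, hε, hev⟩ := exists_le_norm_eval hQ
    refine not_memLp_of_eventually_le (one_pos.trans hR).ne'
      (prodExp_ne_top h.one_lt_s h.one_lt_j) hε hev ?_
    refine (hL.sub ((memLp_inv_lamPlus hR).const_mul c)).ae_eq (Eventually.of_forall fun x => ?_)
    have h3 := lamPlus_ne_zero x
    have e : (x : ℂ) + Complex.I = lamPlus x := rfl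
    simp only [Pi.sub_apply, eval_add, eval_mul, eval_sub, eval_X, eval_C, sub_neg_eq_add, e]
    field_simp
    ring
  subst hQ
  rw [mul_zero, zero_add] at hP hP0
  refine ⟨c, fun hc => hP0 (by rw [hc, C_0]), ?_, ?_⟩
  · filter_upwards [hP] with x hx
    simpa using hx.1
  · filter_upwards [hP] with x hx
    simpa using hx.2

end IsFactorization

end

end JSFactorization

open JSFactorization in
theorem proposition5p2 (j s j' : ℝ) (hj' : 1 / j + 1 / j' = 1)
    (g gm gp gm' gp' : ℝ → ℂ) (k k' : ℤ)
    (h : IsFactorization j s g k gm gp)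
    (h' : IsFactorization j s g k' gm' gp')
    (hk : k' ≤ k) :
    (gp ∈ CalHPlus j' → (fun x => (gm x)⁻¹) ∈ CalHMinus j' →
      k = k' ∧ ∃ C : ℂ, C ≠ 0 ∧
        (∀ᵐ x : ℝ, gp x * (gp' x)⁻¹ = C) ∧ (∀ᵐ x : ℝ, gm' x * (gm x)⁻¹ = C)) ∧
    (s ≠ j' →
      (0 ≤ k - k' ∧ k - k' ≤ 1) ∧
      (k = k' → ∃ C : ℂ, C ≠ 0 ∧
        (∀ᵐ x : ℝ, gp x * (gp' x)⁻¹ = C) ∧ (∀ᵐ x : ℝ, gm' x * (gm x)⁻¹ = C)) ∧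
      (k - k' = 1 → ∃ C : ℂ, C ≠ 0 ∧
        (∀ᵐ x : ℝ, gp' x = 1 / C * (gp x / ((x : ℂ) + Complex.I))) ∧
        (∀ᵐ x : ℝ, gm' x = C * ((x : ℂ) - Complex.I) * gm x))) := by
  obtain ⟨n, rfl⟩ := Int.le.dest hk
  refine ⟨fun hp _ => ?_, fun hs => ⟨⟨by simp, ?_⟩, fun hkk => ?_, fun hkk => ?_⟩⟩
  · obtain rfl := IsFactorization.index_eq_of_conjugate hj' h h' hp
    rw [Nat.cast_zero, add_zero] at h ⊢
    exact ⟨rfl, h.exists_const h'⟩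
  · have := h.index_le_one h'
    omega
  · rw [hkk] at h
    exact h.exists_const h'
  · have hn : (n : ℤ) = 1 := by omega
    rw [hn] at h
    have hjs : 1 / j + 1 / s < 1 := by
      refine h.inv_add_inv_le.lt_of_ne fun he => hs ?_
      have : 1 / s = 1 / j' := by linarith
      simpa using this
    obtain ⟨c, hc, h1, h2⟩ := h.exists_const_of_index_one hjs h'
    refine ⟨c, hc, ?_, ?_⟩
    · filter_upwards [h1, h'.plus_ne_zero] with x hx hx'
      have h3 := lamPlus_ne_zero x
      change _ = 1 / c * (gp x / lamPlus x)
      field_simp at hx ⊢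
      linear_combination -hx
    · filter_upwards [h2, h.minus_ne_zero] with x hx hx'
      change _ = c * lamMinus x * gm x
      rw [← hx, inv_mul_cancel_right₀ hx']
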